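/- **Proposition (isometric Ramsey lower bound for graphs).** There is an absolute constant $c>0$ such that the following holds. Let $G=(V,E)$ be a finite connected unweighted simple graph with $n=|V|\ge 3$ vertices, and let $d_G(u,v)$ be its shortest-path metric, i.e. the least number of edges of a path of $G$ joining $u$ and $v$. Then there is a set $S\subseteq V$ with $$|S|\ \ge\ c\,\sqrt{\frac{\log n}{\log\log n}}$$ such that the metric space $(S,d_G|_{S\times S})$ embeds isometrically into $\ell_2$; that is, there is a map $f:S\to\ell_2$ with $\|f(u)-f(v)\|_2=d_G(u,v)$ for all $u,v\in S$. Here $\log$ is the natural logarithm and $\ell_2$ is the real Hilbert space of square-summable sequences. -/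

import Mathlib

/-- The real Hilbert space `ℓ₂` of square-summable real sequences. -/
abbrev EllTwo : Type := lp (fun _ : ℕ => ℝ) 2

/-- The set `S` of vertices, with the shortest-path distance of the ambient graph `G`
restricted to `S`, embeds isometrically into `ℓ₂`. (Used for connected graphs, where `G.dist`
is the shortest-path metric.) -/
def SimpleGraph.EmbedsIsometricallyInEllTwo {V : Type*} (G : SimpleGraph V) (S : Finset V) :
    Prop :=
  ∃ f : S → EllTwo, ∀ u v : S, ‖f u - f v‖ = (G.dist (u : V) (v : V) : ℝ)

/-! A geodesic of length at least `m` contains `m` points isometric to a subset of a line. If all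
distances are below `m`, colour pairs by distance: with `m` colours and `m ^ (m * m)` vertices,
Ramsey gives `m` equidistant vertices, a regular simplex. Any `m` with `m² log m ≤ log n` is
allowed. -/

/-- Multicolour Ramsey theorem: a symmetric colouring with `q ≥ 2` colours of the pairs from a set
with at least `q ^ ∑ i, a i` elements has, for some colour `i`, a monochromatic set of size `a i`. -/
theorem exists_monochromatic_of_pow_sum_le_card {V ι : Type*} [Fintype ι]
    (hι : 2 ≤ Fintype.card ι) (χ : V → V → ι) (hχ : ∀ u v, χ u v = χ v u) (s : ℕ) :
    ∀ (a : ι → ℕ) (A : Finset V), ∑ i, a i = s → Fintype.card ι ^ s ≤ A.card →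
      ∃ i, ∃ S ⊆ A, a i ≤ S.card ∧ ∀ u ∈ S, ∀ v ∈ S, u ≠ v → χ u v = i := by
  classical
  induction s with
  | zero =>
    intro a A ha _
    have : Nonempty ι := Fintype.card_pos_iff.mp (by omega)
    obtain ⟨i⟩ := this
    have hi : a i = 0 := Finset.sum_eq_zero_iff.mp ha i (Finset.mem_univ i)
    exact ⟨i, ∅, by simp, by simp [hi], by simp⟩
  | succ s ih =>
    intro a A ha hA
    by_cases h0 : ∃ i, a i = 0
    · obtain ⟨i, hi⟩ := h0
      exact ⟨i, ∅, by simp, by simp [hi], by simp⟩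
    push Not at h0
    have hpow : 0 < Fintype.card ι ^ s := pow_pos (by omega) s
    have hcard : Fintype.card ι * (Fintype.card ι ^ s - 1) + Fintype.card ι ≤ A.card := by
      rw [← Nat.mul_succ, Nat.succ_eq_add_one, Nat.sub_add_cancel hpow, mul_comm, ← pow_succ]
      exact hA
    obtain ⟨v, hv⟩ : A.Nonempty := Finset.card_pos.mp (by omega)
    -- With `q ≥ 2` colours, `q * (q ^ s - 1) < q ^ (s + 1) - 1`, so deleting `v` still leaves a
    -- colour class of size at least `q ^ s`.
    obtain ⟨i, -, hi⟩ := Finset.exists_lt_card_fiber_of_mul_lt_card_of_maps_to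
      (s := A.erase v) (t := Finset.univ) (f := χ v) (n := Fintype.card ι ^ s - 1)
      (fun _ _ => Finset.mem_univ _) (by
        rw [Finset.card_univ, Finset.card_erase_of_mem hv]; omega)
    have hsum : ∑ j, Function.update a i (a i - 1) j = s := by
      have h1 := Finset.sum_update_of_mem (Finset.mem_univ i) a (a i - 1)
      have h2 := Finset.add_sum_erase Finset.univ a (Finset.mem_univ i)
      rw [Finset.sdiff_singleton_eq_erase] at h1
      have := h0 i
      omega
    obtain ⟨j, S, hSA, hS, hmono⟩ := ih _ _ hsum (Nat.le_of_pred_lt hi)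
    have hSA' : S ⊆ A := fun x hx =>
      Finset.mem_of_mem_erase (Finset.mem_filter.mp (hSA hx)).1
    by_cases hij : j = i
    · subst hij
      have hvS : v ∉ S := fun h => by simpa using hSA h
      refine ⟨j, insert v S, Finset.insert_subset hv hSA', ?_, ?_⟩
      · rw [Function.update_self] at hS
        rw [Finset.card_insert_of_notMem hvS]
        omega
      · have hvx : ∀ x ∈ S, χ v x = j := fun x hx => (Finset.mem_filter.mp (hSA hx)).2
        intro x hx y hy hxy
        rcases Finset.mem_insert.mp hx with rfl | hx' <;>
          rcases Finset.mem_insert.mp hy with rfl | hy'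
        · exact absurd rfl hxy
        · exact hvx y hy'
        · rw [hχ]; exact hvx x hx'
        · exact hmono x hx' y hy' hxy
    · rw [Function.update_of_ne hij] at hS
      exact ⟨j, S, hSA', hS, hmono⟩

theorem exists_orthonormal_ellTwo : ∃ e : ℕ → EllTwo, Orthonormal ℝ e :=
  ⟨_, (HilbertBasis.ofRepr (LinearIsometryEquiv.refl ℝ EllTwo)).orthonormal⟩

theorem Orthonormal.norm_sub_of_ne {E ι : Type*} [NormedAddCommGroup E] [InnerProductSpace ℝ E]
    {e : ι → E} (he : Orthonormal ℝ e) {i j : ι} (hij : i ≠ j) : ‖e i - e j‖ = √2 := by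
  have h := norm_sub_sq_real (e i) (e j)
  rw [he.1 i, he.1 j, he.2 hij] at h
  rw [← Real.sqrt_sq (norm_nonneg (e i - e j)), h]
  norm_num

namespace SimpleGraph

variable {V : Type*} {G : SimpleGraph V}

theorem embedsIsometricallyInEllTwo_of_equilateral (S : Finset V) (r : ℕ)
    (hS : ∀ u ∈ S, ∀ v ∈ S, u ≠ v → G.dist u v = r) : G.EmbedsIsometricallyInEllTwo S := by
  obtain ⟨e, he⟩ := exists_orthonormal_ellTwo
  refine ⟨fun u => ((r : ℝ) / √2) • e (S.equivFin u), fun u v => ?_⟩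
  by_cases huv : u = v
  · simp [huv]
  · have hne : (S.equivFin u : ℕ) ≠ S.equivFin v := fun h =>
      huv (S.equivFin.injective (Fin.ext h))
    rw [← smul_sub, norm_smul, he.norm_sub_of_ne hne, Real.norm_of_nonneg (by positivity),
      div_mul_cancel₀ _ (by positivity),
      hS u u.2 v v.2 fun h => huv (Subtype.ext h)]

theorem embedsIsometricallyInEllTwo_of_line (S : Finset V) (g : V → ℝ)
    (hS : ∀ u ∈ S, ∀ v ∈ S, |g u - g v| = G.dist u v) : G.EmbedsIsometricallyInEllTwo S := by
  obtain ⟨e, he⟩ := exists_orthonormal_ellTwo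
  refine ⟨fun u => g u • e 0, fun u v => ?_⟩
  rw [← sub_smul, norm_smul, he.1 0, mul_one, Real.norm_eq_abs, hS u u.2 v v.2]

/-- Two vertices at distance at least `m` are joined by a geodesic, which is a copy of a line. -/
theorem Connected.exists_embedsIsometrically_of_le_dist (hG : G.Connected) {u v : V} {m : ℕ}
    (hm : m ≤ G.dist u v) : ∃ S : Finset V, S.card = m ∧ G.EmbedsIsometricallyInEllTwo S := by
  classical
  obtain ⟨p, hp⟩ := hG.exists_walk_length_eq_dist u v
  have key : ∀ i j, i ≤ j → j < m → G.dist (p.getVert i) (p.getVert j) = j - i := by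
    intro i j hij hj
    have h1 : G.dist u (p.getVert i) ≤ i := (dist_le (p.take i)).trans (by simp)
    have h2 : G.dist (p.getVert j) v ≤ p.length - j := (dist_le (p.drop j)).trans (by simp)
    have h3 : G.dist (p.getVert i) (p.getVert j) ≤ j - i := by
      have h := (dist_le ((p.drop i).take (j - i))).trans
        (show _ ≤ j - i by simp)
      rwa [Walk.drop_getVert, Nat.add_sub_cancel' hij] at h
    -- A strict inequality in `h3` would make `u` and `v` closer than `p.length`.
    have h4 := hG.dist_triangle (u := u) (v := p.getVert i) (w := v)
    have h5 := hG.dist_triangle (u := p.getVert i) (v := p.getVert j) (w := v)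
    omega
  have habs : ∀ i < m, ∀ j < m,
      |(i : ℝ) - j| = G.dist (p.getVert i) (p.getVert j) := by
    intro i hi j hj
    rcases le_total i j with h | h
    · rw [key i j h hj, Nat.cast_sub h, abs_sub_comm, abs_of_nonneg]
      simpa using h
    · rw [dist_comm, key j i h hi, Nat.cast_sub h, abs_of_nonneg]
      simpa using h
  have hstart : ∀ i < m, G.dist u (p.getVert i) = i := by
    intro i hi
    simpa using key 0 i (Nat.zero_le i) hi
  refine ⟨(Finset.range m).image p.getVert, ?_, ?_⟩
  · rw [Finset.card_image_of_injOn, Finset.card_range]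
    intro i hi j hj hij
    rw [← hstart i (by simpa using hi), ← hstart j (by simpa using hj), hij]
  · refine embedsIsometricallyInEllTwo_of_line _ (fun x => G.dist u x) ?_
    intro x hx y hy
    obtain ⟨i, hi, rfl⟩ := Finset.mem_image.mp hx
    obtain ⟨j, hj, rfl⟩ := Finset.mem_image.mp hy
    rw [Finset.mem_range] at hi hj
    rw [hstart i hi, hstart j hj, habs i hi j hj]

theorem Connected.exists_embedsIsometrically_of_pow_le_card [Fintype V] (hG : G.Connected)
    {m : ℕ} (hm : m ^ (m * m) ≤ Fintype.card V) :
    ∃ S : Finset V, m ≤ S.card ∧ G.EmbedsIsometricallyInEllTwo S := by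
  by_cases hdiam : ∃ u v, m ≤ G.dist u v
  · obtain ⟨u, v, huv⟩ := hdiam
    obtain ⟨S, hS, hemb⟩ := hG.exists_embedsIsometrically_of_le_dist huv
    exact ⟨S, hS.ge, hemb⟩
  push Not at hdiam
  obtain hm2 | hm2 := Nat.lt_or_ge m 2
  · obtain ⟨v⟩ := hG.nonempty
    refine ⟨{v}, by rw [Finset.card_singleton]; omega,
      embedsIsometricallyInEllTwo_of_equilateral _ 0 ?_⟩
    intro x hx y hy hxy
    rw [Finset.mem_singleton] at hx hy
    exact absurd (hx.trans hy.symm) hxy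
  · obtain ⟨i, S, -, hS, hmono⟩ := exists_monochromatic_of_pow_sum_le_card (ι := Fin m)
      (by simpa using hm2) (fun u v => ⟨G.dist u v, hdiam u v⟩)
      (fun u v => Fin.ext dist_comm) (m * m) (fun _ => m) Finset.univ (by simp) (by simpa using hm)
    exact ⟨S, hS, embedsIsometricallyInEllTwo_of_equilateral S i fun u hu v hv huv =>
      congrArg Fin.val (hmono u hu v hv huv)⟩

end SimpleGraph

theorem exists_pow_mul_self_le (n : ℕ) (hn : 3 ≤ n) :
    ∃ m : ℕ, m ^ (m * m) ≤ n ∧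
      1 / 8 * √(Real.log n / Real.log (Real.log n)) ≤ (m : ℝ) := by
  set L := Real.log n with hL
  set T := √(L / Real.log L) with hT
  have hn' : (3 : ℝ) ≤ n := by exact_mod_cast hn
  -- As `log 3 > 17/16`, `L log L ≥ L - 1 ≥ 1/16`, matching the `1/16` from `(T / 4) ^ 2`.
  have hL1 : 17 / 16 ≤ L := by
    have h1 := Real.log_three_gt_d9
    have h2 := Real.log_le_log (by norm_num) hn'
    norm_num at h1 ⊢
    linarith
  have hll : 1 / 16 ≤ L * Real.log L := by
    have h := Real.one_sub_inv_le_log_of_pos (show 0 < L by linarith)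
    have h2 := mul_le_mul_of_nonneg_left h (show 0 ≤ L by linarith)
    rw [mul_sub, mul_inv_cancel₀ (by linarith)] at h2
    linarith
  have hllpos : 0 < Real.log L := Real.log_pos (by linarith)
  have hTsq : T ^ 2 * Real.log L = L := by
    rw [hT, Real.sq_sqrt (by positivity)]
    field_simp
  have hT0 : 0 ≤ T := Real.sqrt_nonneg _
  obtain hT4 | hT4 := lt_or_ge T 4
  · exact ⟨1, by rw [one_pow]; omega, by push_cast; linarith⟩
  set m := ⌊T / 4⌋₊
  have hm1 : 1 ≤ m := Nat.le_floor (by push_cast; linarith)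
  have hm1' : (1 : ℝ) ≤ m := by exact_mod_cast hm1
  refine ⟨m, ?_, ?_⟩
  · have hmT : (m : ℝ) ≤ T / 4 := Nat.floor_le (by positivity)
    have hmsq : (m : ℝ) ^ 2 * Real.log L ≤ L / 16 := by
      have : (m : ℝ) ^ 2 ≤ (T / 4) ^ 2 := by gcongr
      nlinarith
    -- `m² / 16 ≤ m² L log L ≤ L² / 16`.
    have hmL : (m : ℝ) ≤ L := by
      refine (abs_le_of_sq_le_sq' ?_ (by linarith)).2
      have h1 : (m : ℝ) ^ 2 * (1 / 16) ≤ (m : ℝ) ^ 2 * (L * Real.log L) := by gcongr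
      nlinarith
    have hlog : Real.log m ≤ Real.log L := Real.log_le_log (by linarith) hmL
    have hfin : Real.log ((m ^ (m * m) : ℕ) : ℝ) ≤ Real.log n := by
      push_cast
      rw [Real.log_pow, ← hL]
      push_cast
      have : (m : ℝ) ^ 2 * Real.log m ≤ (m : ℝ) ^ 2 * Real.log L := by gcongr
      nlinarith
    exact_mod_cast (Real.log_le_log_iff (by positivity) (by linarith)).mp hfin
  -- Since `m ≥ 1`, `m ≥ (m + 1) / 2 > T / 8`.
  · have : T / 4 < m + 1 := Nat.lt_floor_add_one (T / 4)
    linarith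

theorem mainTheorem8 :
    ∃ c : ℝ, 0 < c ∧
      ∀ (V : Type*) [Fintype V] (G : SimpleGraph V), G.Connected → 3 ≤ Fintype.card V →
        ∃ S : Finset V,
          c * Real.sqrt (Real.log (Fintype.card V : ℝ) / Real.log (Real.log (Fintype.card V : ℝ)))
              ≤ (S.card : ℝ) ∧
            G.EmbedsIsometricallyInEllTwo S := by
  refine ⟨1 / 8, by norm_num, fun V _ G hG hn => ?_⟩
  obtain ⟨m, hm, hle⟩ := exists_pow_mul_self_le (Fintype.card V) hn
  obtain ⟨S, hS, hemb⟩ := hG.exists_embedsIsometrically_of_pow_le_card hm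
  exact ⟨S, hle.trans (by exact_mod_cast hS), hemb⟩
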